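/- We work in many-sorted first-order logic with equality. A signature $\Sigma$ has a nonempty set $\mathcal S_\Sigma$ of sorts, function symbols and predicate symbols with arities over $\mathcal S_\Sigma$, and a (built-in) equality symbol for every sort; two signatures are disjoint if they share at most sorts and equality symbols. For every sort there are countably infinitely many variables. Structures interpret every sort by a nonempty set and equality by identity; an interpretation is a structure with an assignment of values to the variables. A $\Sigma$-theory $\mathcal T$ is a set of $\Sigma$-sentences, a $\mathcal T$-interpretation is an interpretation satisfying $\mathcal T$, and a formula is $\mathcal T$-satisfiable if some $\mathcal T$-interpretation satisfies it. $\mathit{vars}(\varphi)$, $\mathit{vars}_\sigma(\varphi)$ and $\mathit{vars}_S(\varphi)$ denote the sets of free variables of $\varphi$, of those of sort $\sigma$, and of those whose sort lies in $S$. For a finite set $V$ of variables and an equivalence relation $E_\sigma$ on the variables of sort $\sigma$ in $V$, for each sort $\sigma$, the induced arrangement $\delta_V$ is the conjunction, over all sorts $\sigma$, of the formulas $x=y$ for $x\,E_\sigma\,y$ and $\neg(x=y)$ for all other pairs $x,y\in V$ of sort $\sigma$. Let $S\subseteq\mathcal S_\Sigma$. The theory $\mathcal T$ is stably infinite with respect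 to $S$ if every $\mathcal T$-satisfiable quantifier-free formula is satisfied by a $\mathcal T$-interpretation $\mathcal A$ in which $\sigma^{\mathcal A}$ is infinite for every $\sigma\in S$. It is strongly finitely witnessable with respect to $S$, with witness function $\mathit{wit}$, if $\mathit{wit}$ is a computable function (with respect to a Gödel numbering) from the quantifier-free $\Sigma$-formulas to themselves such that for every quantifier-free $\varphi$: (i) $\varphi$ and $\exists\vec w\,\mathit{wit}(\varphi)$ are satisfied by the same $\mathcal T$-interpretations, where $\vec w=\mathit{vars}(\mathit{wit}(\varphi))\setminus\mathit{vars}(\varphi)$; and (ii) for every finite set $V$ of variables with sorts in $S$ and every arrangement $\delta_V$ on $V$, if $\mathit{wit}(\varphi)\wedge\delta_V$ is $\mathcal T$-satisfiable, then it is satisfied by a $\mathcal T$-interpretation $\mathcal A$ such that $\sigma^{\mathcal A}=\{x^{\mathcal A} : x\in\mathit{vars}_\sigma(\mathit{wit}(\varphi)\wedge\delta_V)\}$ for every $\sigma\in S$. Theorem. Let $\Sigma_1$ and $\Sigma_2$ be disjoint countable signatures, let $\mathcal T_1$ and $\mathcal T_2$ be $\Sigma_1$- and $\Sigma_2$-theories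 respectively, and let $\varphi_1$ and $\varphi_2$ be quantifier-free $\Sigma_1$- and $\Sigma_2$-formulas respectively. Let $S=\mathcal S_{\Sigma_1}\cap\mathcal S_{\Sigma_2}$, suppose that $\mathcal T_1$ is stably infinite and strongly finitely witnessable, both with respect to $S$, with witness function $\mathit{wit}$, and let $V=\mathit{vars}_S(\mathit{wit}(\varphi_1))$. Consider the statements (a) $\varphi_1\wedge\varphi_2$ is $(\mathcal T_1\cup\mathcal T_2)$-satisfiable; (b) there is an arrangement $\delta_V$ on $V$ such that $\mathit{wit}(\varphi_1)\wedge\delta_V$ is $\mathcal T_1$-satisfiable and $\varphi_2\wedge\delta_V$ is $\mathcal T_2$-satisfiable. Then (b) implies (a). If the variables introduced by $\mathit{wit}$ are fresh for $\varphi_2$, that is, if no variable in $\mathit{vars}(\mathit{wit}(\varphi_1))\setminus\mathit{vars}(\varphi_1)$ occurs in $\varphi_2$, then (a) implies (b), so that (a) and (b) are equivalent. -/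

import Mathlib

universe u

namespace ManySorted

/-- The data of a many-sorted signature: sorts, function symbols with their arities
`(dom f 0, …, dom f (n-1), cod f)` and predicate symbols with their arities. The equality symbol of
each sort is not listed among the predicate symbols; it is built into the formulas below. -/
structure Signature where
  Sorts : Type u
  Func : Type u
  Pred : Type u
  funcArity : Func → ℕ
  dom : (f : Func) → Fin (funcArity f) → Sorts
  cod : Func → Sorts
  predArity : Pred → ℕ
  pdom : (P : Pred) → Fin (predArity P) → Sorts

variable {L : Signature.{u}}

/-- Variables: for every sort `σ` there are the variables `(σ, 0), (σ, 1), …` of sort `σ`. -/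
abbrev Var (L : Signature.{u}) : Type u := L.Sorts × ℕ

/-- Terms, indexed by their sort. -/
inductive Term (L : Signature.{u}) : L.Sorts → Type u
  | var (σ : L.Sorts) (n : ℕ) : Term L σ
  | app (f : L.Func) (args : (i : Fin (L.funcArity f)) → Term L (L.dom f i)) : Term L (L.cod f)

/-- First-order formulas; the other connectives and `∃` are defined below. -/
inductive Formula (L : Signature.{u}) : Type u
  | falsum : Formula L
  | eq {σ : L.Sorts} (s t : Term L σ) : Formula L
  | pred (P : L.Pred) (args : (i : Fin (L.predArity P)) → Term L (L.pdom P i)) : Formula L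
  | imp (φ ψ : Formula L) : Formula L
  | all (x : Var L) (φ : Formula L) : Formula L

namespace Formula

def neg (φ : Formula L) : Formula L := φ.imp falsum

def verum : Formula L := falsum.neg

def and (φ ψ : Formula L) : Formula L := (φ.imp ψ.neg).neg

def ex (x : Var L) (φ : Formula L) : Formula L := (all x φ.neg).neg

/-- Finite conjunction; the empty conjunction is `⊤`. -/
def conj (l : List (Formula L)) : Formula L := l.foldr and verum

/-- `∃ x₁ … ∃ xₖ, φ` for a list `x₁, …, xₖ` of variables. -/
def exs (l : List (Var L)) (φ : Formula L) : Formula L := l.foldr ex φ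

def IsQF : Formula L → Prop
  | falsum => True
  | eq _ _ => True
  | pred _ _ => True
  | imp φ ψ => φ.IsQF ∧ ψ.IsQF
  | all _ _ => False

end Formula

/-- Quantifier-free formulas. -/
abbrev QFFormula (L : Signature.{u}) : Type u := {φ : Formula L // φ.IsQF}

open Classical in
noncomputable def Term.vars : {σ : L.Sorts} → Term L σ → Finset (Var L)
  | _, .var σ n => {(σ, n)}
  | _, .app _ args => Finset.univ.biUnion fun i => (args i).vars

open Classical in
/-- The set `vars(φ)` of free variables. -/
noncomputable def Formula.freeVars : Formula L → Finset (Var L)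
  | .falsum => ∅
  | .eq s t => s.vars ∪ t.vars
  | .pred _ args => Finset.univ.biUnion fun i => (args i).vars
  | .imp φ ψ => φ.freeVars ∪ ψ.freeVars
  | .all x φ => φ.freeVars.erase x

abbrev Sentence (L : Signature.{u}) : Type u := {φ : Formula L // φ.freeVars = ∅}

/-- A theory is a set of sentences, its axioms. -/
abbrev Theory (L : Signature.{u}) : Type u := Set (Sentence L)

/-- Structures: every sort is interpreted as a nonempty set. -/
structure Structure (L : Signature.{u}) where
  carrier : L.Sorts → Type u
  nonempty : ∀ σ, Nonempty (carrier σ)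
  func : (f : L.Func) → ((i : Fin (L.funcArity f)) → carrier (L.dom f i)) → carrier (L.cod f)
  pred : (P : L.Pred) → ((i : Fin (L.predArity P)) → carrier (L.pdom P i)) → Prop

/-- Assignments of values to all variables. -/
abbrev Assignment (A : Structure L) : Type u := (x : Var L) → A.carrier x.1

def Term.eval (A : Structure L) (ν : Assignment A) : {σ : L.Sorts} → Term L σ → A.carrier σ
  | _, .var σ n => ν (σ, n)
  | _, .app f args => A.func f fun i => (args i).eval A ν

open Classical in
/-- `Holds A φ ν` means `(A, ν) ⊨ φ`. Equality is interpreted as identity. -/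
def Formula.Holds (A : Structure L) : Formula L → Assignment A → Prop
  | .falsum, _ => False
  | .eq s t, ν => s.eval A ν = t.eval A ν
  | .pred P args, ν => A.pred P fun i => (args i).eval A ν
  | .imp φ ψ, ν => φ.Holds A ν → ψ.Holds A ν
  | .all x φ, ν => ∀ a : A.carrier x.1, φ.Holds A (Function.update ν x a)

/-- An interpretation is a structure together with an assignment. -/
structure Interpretation (L : Signature.{u}) where
  str : Structure L
  val : Assignment str

def Interpretation.Satisfies (A : Interpretation L) (φ : Formula L) : Prop :=
  φ.Holds A.str A.val

/-- `A` is a `T`-interpretation. -/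
def Interpretation.IsModel (A : Interpretation L) (T : Theory L) : Prop :=
  ∀ ψ ∈ T, A.Satisfies ψ.1

def Theory.Satisfiable (T : Theory L) (φ : Formula L) : Prop :=
  ∃ A : Interpretation L, A.IsModel T ∧ A.Satisfies φ

def Theory.Equivalent (T : Theory L) (φ ψ : Formula L) : Prop :=
  ∀ A : Interpretation L, A.IsModel T → (A.Satisfies φ ↔ A.Satisfies ψ)

/-- Stable infiniteness with respect to the set `S` of sorts. -/
def Theory.StablyInfinite (T : Theory L) (S : Set L.Sorts) : Prop :=
  ∀ φ : QFFormula L, T.Satisfiable φ.1 →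
    ∃ A : Interpretation L, A.IsModel T ∧ A.Satisfies φ.1 ∧
      ∀ σ ∈ S, Infinite (A.str.carrier σ)

open Classical in
/-- The arrangement on the finite set `V` of variables induced by the equivalence relations `E σ`:
for every sort `σ`, the conjunction of `x = y` over all `x, y ∈ V` of sort `σ` with `x E_σ y`
(including `x = x`) and of `¬ x = y` over all other `x, y ∈ V` of sort `σ`. The relation `E σ` is
given on (the indices of) all variables of sort `σ`, but only its restriction to `V` is used; every
equivalence relation on a subset of `ℕ` is such a restriction. -/
noncomputable def arrangement (V : Finset (Var L)) (E : L.Sorts → Setoid ℕ) : Formula L :=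
  Formula.conj <| (V.image Prod.fst).toList.map fun σ =>
    let W : Finset ℕ := (V.filter fun x => x.1 = σ).image Prod.snd
    Formula.conj <| (W ×ˢ W).toList.map fun p =>
      if (E σ).r p.1 p.2 then Formula.eq (Term.var σ p.1) (Term.var σ p.2)
      else (Formula.eq (Term.var σ p.1) (Term.var σ p.2)).neg

/-- A numbering of the symbols of a signature; it exists if and only if the signature is
countable. -/
structure Numbering (L : Signature.{u}) where
  sort : L.Sorts → ℕ
  func : L.Func → ℕ
  pred : L.Pred → ℕ
  sort_injective : Function.Injective sort
  func_injective : Function.Injective func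
  pred_injective : Function.Injective pred

/-- Gödel numbers of terms. -/
def Term.code (N : Numbering L) : {σ : L.Sorts} → Term L σ → ℕ
  | _, .var σ n => 2 * Nat.pair (N.sort σ) n
  | _, .app f args =>
      2 * Nat.pair (N.func f) (Encodable.encode (List.ofFn fun i => (args i).code N)) + 1

/-- Gödel numbers of formulas. -/
def Formula.code (N : Numbering L) : Formula L → ℕ
  | .falsum => 0
  | .eq s t => 4 * Nat.pair (s.code N) (t.code N) + 1
  | .pred P args =>
      4 * Nat.pair (N.pred P) (Encodable.encode (List.ofFn fun i => (args i).code N)) + 2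
  | .imp φ ψ => 4 * Nat.pair (φ.code N) (ψ.code N) + 3
  | .all x φ => 4 * Nat.pair (Nat.pair (N.sort x.1) x.2) (φ.code N) + 4

/-- A function on quantifier-free formulas is computable if some partial recursive function takes
the Gödel number of each `φ` to the Gödel number of its image. -/
def IsComputable (N : Numbering L) (w : QFFormula L → QFFormula L) : Prop :=
  ∃ g : ℕ →. ℕ, Nat.Partrec g ∧ ∀ φ : QFFormula L, (w φ).1.code N ∈ g (φ.1.code N)

open Classical in
/-- `wit` is a strong witness function for `T` with respect to `S`. The theory `T` is *strongly
finitely witnessable* with respect to `S` if there is such a function. -/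
structure Theory.IsStrongWitness (T : Theory L) (S : Set L.Sorts) (N : Numbering L)
    (wit : QFFormula L → QFFormula L) : Prop where
  computable : IsComputable N wit
  equivalent : ∀ φ : QFFormula L,
    T.Equivalent φ.1 ((wit φ).1.exs ((wit φ).1.freeVars \ φ.1.freeVars).toList)
  witness : ∀ (φ : QFFormula L) (V : Finset (Var L)) (E : L.Sorts → Setoid ℕ),
    (∀ x ∈ V, x.1 ∈ S) →
    T.Satisfiable ((wit φ).1.and (arrangement V E)) →
    ∃ A : Interpretation L, A.IsModel T ∧ A.Satisfies ((wit φ).1.and (arrangement V E)) ∧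
      ∀ σ ∈ S, ∀ a : A.str.carrier σ,
        ∃ n : ℕ, (σ, n) ∈ ((wit φ).1.and (arrangement V E)).freeVars ∧ A.val (σ, n) = a

/-- Signatures whose symbols are taken from a common stock `K` of sorts and symbols, in which every
symbol has an arity: sets of sorts, of function symbols and of predicate symbols that contain the
sorts occurring in the arities of their symbols. -/
structure Subsignature (K : Signature.{u}) where
  sorts : Set K.Sorts
  funcs : Set K.Func
  preds : Set K.Pred
  dom_mem : ∀ f ∈ funcs, ∀ i, K.dom f i ∈ sorts
  cod_mem : ∀ f ∈ funcs, K.cod f ∈ sorts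
  pdom_mem : ∀ P ∈ preds, ∀ i, K.pdom P i ∈ sorts

namespace Subsignature

variable {K : Signature.{u}}

/-- A subsignature as a signature in its own right. -/
@[reducible] def sig (M : Subsignature K) : Signature.{u} where
  Sorts := M.sorts
  Func := M.funcs
  Pred := M.preds
  funcArity f := K.funcArity f.1
  dom f i := ⟨K.dom f.1 i, M.dom_mem f.1 f.2 i⟩
  cod f := ⟨K.cod f.1, M.cod_mem f.1 f.2⟩
  predArity P := K.predArity P.1
  pdom P i := ⟨K.pdom P.1 i, M.pdom_mem P.1 P.2 i⟩

/-- A signature is countable if it has countably many sorts and symbols. -/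
structure IsCountable (M : Subsignature K) : Prop where
  sorts : M.sorts.Countable
  funcs : M.funcs.Countable
  preds : M.preds.Countable

/-- Disjoint signatures share at most sorts (and their equality symbols). -/
structure SharesOnlySorts (M M' : Subsignature K) : Prop where
  funcs : Disjoint M.funcs M'.funcs
  preds : Disjoint M.preds M'.preds

structure Included (M M' : Subsignature K) : Prop where
  sorts : M.sorts ⊆ M'.sorts
  funcs : M.funcs ⊆ M'.funcs
  preds : M.preds ⊆ M'.preds

instance : HasSubset (Subsignature K) := ⟨Included⟩

/-- The union of two signatures. -/
instance : Union (Subsignature K) where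
  union M M' :=
    { sorts := M.sorts ∪ M'.sorts
      funcs := M.funcs ∪ M'.funcs
      preds := M.preds ∪ M'.preds
      dom_mem := fun f hf i => hf.imp (fun h => M.dom_mem f h i) (fun h => M'.dom_mem f h i)
      cod_mem := fun f hf => hf.imp (fun h => M.cod_mem f h) (fun h => M'.cod_mem f h)
      pdom_mem := fun P hP i => hP.imp (fun h => M.pdom_mem P h i) (fun h => M'.pdom_mem P h i) }

/-- The common part of two signatures; if they are disjoint, it consists of the shared sorts only. -/
instance : Inter (Subsignature K) where
  inter M M' :=
    { sorts := M.sorts ∩ M'.sorts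
      funcs := M.funcs ∩ M'.funcs
      preds := M.preds ∩ M'.preds
      dom_mem := fun f hf i => ⟨M.dom_mem f hf.1 i, M'.dom_mem f hf.2 i⟩
      cod_mem := fun f hf => ⟨M.cod_mem f hf.1, M'.cod_mem f hf.2⟩
      pdom_mem := fun P hP i => ⟨M.pdom_mem P hP.1 i, M'.pdom_mem P hP.2 i⟩ }

theorem subset_union_left (M M' : Subsignature K) : M ⊆ M ∪ M' :=
  ⟨Set.subset_union_left, Set.subset_union_left, Set.subset_union_left⟩

theorem subset_union_right (M M' : Subsignature K) : M' ⊆ M ∪ M' :=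
  ⟨Set.subset_union_right, Set.subset_union_right, Set.subset_union_right⟩

theorem inter_subset_left (M M' : Subsignature K) : M ∩ M' ⊆ M :=
  ⟨Set.inter_subset_left, Set.inter_subset_left, Set.inter_subset_left⟩

theorem inter_subset_right (M M' : Subsignature K) : M ∩ M' ⊆ M' :=
  ⟨Set.inter_subset_right, Set.inter_subset_right, Set.inter_subset_right⟩

end Subsignature

section Inclusion

variable {K : Signature.{u}} {M M' : Subsignature K}

/-- A variable of a smaller signature as a variable of a larger one. -/
def inclVar (h : M ⊆ M') (x : Var M.sig) : Var M'.sig := (⟨x.1.1, h.sorts x.1.2⟩, x.2)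

theorem inclVar_injective (h : M ⊆ M') : Function.Injective (inclVar h) := by
  rintro ⟨⟨σ, hσ⟩, n⟩ ⟨⟨τ, hτ⟩, m⟩ hxy
  simp only [inclVar, Prod.mk.injEq, Subtype.mk.injEq] at hxy ⊢
  exact hxy

/-- A term of a smaller signature as a term of a larger one. -/
def Term.incl (h : M ⊆ M') : {σ : M.sig.Sorts} → Term M.sig σ →
    Term M'.sig ⟨σ.1, h.sorts σ.2⟩
  | _, .var σ n => .var (L := M'.sig) ⟨σ.1, h.sorts σ.2⟩ n
  | _, .app f args => .app (L := M'.sig) ⟨f.1, h.funcs f.2⟩ fun i => (args i).incl h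

/-- A formula of a smaller signature as a formula of a larger one. -/
def Formula.incl (h : M ⊆ M') : Formula M.sig → Formula M'.sig
  | .falsum => .falsum
  | .eq s t => .eq (s.incl h) (t.incl h)
  | .pred P args => .pred (L := M'.sig) ⟨P.1, h.preds P.2⟩ fun i => (args i).incl h
  | .imp φ ψ => .imp (φ.incl h) (ψ.incl h)
  | .all x φ => .all (inclVar h x) (φ.incl h)

theorem Term.exists_of_mem_vars_incl (h : M ⊆ M') {σ : M.sig.Sorts} (t : Term M.sig σ)
    (x : Var M'.sig) (hx : x ∈ (t.incl h).vars) : ∃ y ∈ t.vars, inclVar h y = x := by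
  induction t with
  | var σ n =>
    simp only [Term.incl, Term.vars, Finset.mem_singleton] at hx
    exact ⟨(σ, n), by simp [Term.vars], hx.symm⟩
  | app f args ih =>
    simp only [Term.incl, Term.vars, Finset.mem_biUnion, Finset.mem_univ, true_and] at hx
    obtain ⟨i, hi⟩ := hx
    obtain ⟨y, hy, hyx⟩ := ih i hi
    refine ⟨y, ?_, hyx⟩
    simp only [Term.vars, Finset.mem_biUnion, Finset.mem_univ, true_and]
    exact ⟨i, hy⟩

theorem Formula.exists_of_mem_freeVars_incl (h : M ⊆ M') (φ : Formula M.sig)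
    (x : Var M'.sig) (hx : x ∈ (φ.incl h).freeVars) : ∃ y ∈ φ.freeVars, inclVar h y = x := by
  induction φ with
  | falsum => simp [Formula.incl, Formula.freeVars] at hx
  | eq s t =>
    simp only [Formula.incl, Formula.freeVars, Finset.mem_union] at hx ⊢
    rcases hx with hx | hx
    · obtain ⟨y, hy, e⟩ := s.exists_of_mem_vars_incl h x hx
      exact ⟨y, Or.inl hy, e⟩
    · obtain ⟨y, hy, e⟩ := t.exists_of_mem_vars_incl h x hx
      exact ⟨y, Or.inr hy, e⟩
  | pred P args =>
    simp only [Formula.incl, Formula.freeVars, Finset.mem_biUnion, Finset.mem_univ,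
      true_and] at hx ⊢
    obtain ⟨i, hi⟩ := hx
    obtain ⟨y, hy, e⟩ := (args i).exists_of_mem_vars_incl h x hi
    exact ⟨y, ⟨i, hy⟩, e⟩
  | imp φ ψ ihφ ihψ =>
    simp only [Formula.incl, Formula.freeVars, Finset.mem_union] at hx ⊢
    rcases hx with hx | hx
    · obtain ⟨y, hy, e⟩ := ihφ hx
      exact ⟨y, Or.inl hy, e⟩
    · obtain ⟨y, hy, e⟩ := ihψ hx
      exact ⟨y, Or.inr hy, e⟩
  | all z φ ih =>
    simp only [Formula.incl, Formula.freeVars, Finset.mem_erase] at hx ⊢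
    obtain ⟨y, hy, e⟩ := ih hx.2
    refine ⟨y, ⟨?_, hy⟩, e⟩
    rintro rfl
    exact hx.1 e.symm

/-- A sentence of a smaller signature as a sentence of a larger one. -/
def Sentence.incl (h : M ⊆ M') (φ : Sentence M.sig) : Sentence M'.sig :=
  ⟨φ.1.incl h, Finset.eq_empty_of_forall_notMem fun x hx => by
    obtain ⟨y, hy, -⟩ := φ.1.exists_of_mem_freeVars_incl h x hx
    simp [φ.2] at hy⟩

/-- The union of two theories, a theory over the union of their signatures. -/
def Theory.union (T : Theory M.sig) (T' : Theory M'.sig) : Theory (M ∪ M').sig :=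
  Sentence.incl (M.subset_union_left M') '' T ∪ Sentence.incl (M.subset_union_right M') '' T'

/-- The variables of shared sort that are free in the formula `φ` over the first signature. -/
noncomputable def sharedVars (M M' : Subsignature K) (φ : Formula M.sig) :
    Finset (Var (M ∩ M').sig) :=
  φ.freeVars.preimage (inclVar (M.inter_subset_left M')) (inclVar_injective _).injOn

/-- The set of shared sorts, as a set of sorts of the first signature. -/
def sharedSorts (M M' : Subsignature K) : Set M.sig.Sorts := {σ | σ.1 ∈ M'.sorts}

end Inclusion

end ManySorted

open ManySorted

/-! For (b) ⇒ (a): models of the two theories can be glued once they agree on the cardinalities of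
the shared sorts and on which shared variables coincide (`exists_amalgam`). Between countable models
only finite shared sorts are an obstacle, and nothing controls their size on the side of the second
theory. So the model of the first theory is made to imitate a fixed countable model B of the second.

Let the variables of each sort enumerate B, keeping the values that matter for φ₂ and δ_V. The
kernel of this enumeration is an equivalence relation on all variables of the sort, with one class
for each element of B. Stable infiniteness makes every finite part of it compatible with wit(φ₁),
since new classes can receive new values. Strong witnessability then gives models whose shared sorts
consist of values of variables. An ultraproduct of them over the finite sets of variables realises
the whole relation; where there are finitely many classes every element is still named, so the sort
has the size it has in B, and elsewhere it is infinite. Löwenheim–Skolem makes this model countable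
(`Theory.IsStrongWitness.exists_countable_model`), and `exists_equiv_of_ker_eq` supplies the
bijections for the gluing.

For (a) ⇒ (b): choose values for the variables introduced by wit in the given model and let δ_V
record which values coincide. Freshness keeps φ₂ true under the changed assignment. -/

namespace ManySorted

open scoped Classical

/-! ### Coincidence lemma and semantics of connectives and arrangements -/

section Semantics

variable {L : Signature.{u}}

theorem Term.eval_congr {A : Structure L} {ν μ : Assignment A} {σ : L.Sorts} (t : Term L σ)
    (h : ∀ x ∈ t.vars, ν x = μ x) : t.eval A ν = t.eval A μ := by
  induction t with
  | var σ n => exact h _ (by simp [Term.vars])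
  | app f args ih =>
    simp only [Term.eval]
    congr 1
    funext i
    exact ih i fun x hx => h x (by
      simp only [Term.vars, Finset.mem_biUnion, Finset.mem_univ, true_and]
      exact ⟨i, hx⟩)

namespace Formula

/-- Satisfaction depends only on the values of the free variables. -/
theorem holds_congr {A : Structure L} (φ : Formula L) {ν μ : Assignment A}
    (h : ∀ x ∈ φ.freeVars, ν x = μ x) : φ.Holds A ν ↔ φ.Holds A μ := by
  induction φ generalizing ν μ with
  | falsum => exact Iff.rfl
  | eq s t =>
    simp only [freeVars, Finset.mem_union] at h
    simp only [Holds]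
    rw [s.eval_congr fun x hx => h x (Or.inl hx), t.eval_congr fun x hx => h x (Or.inr hx)]
  | pred P args =>
    simp only [Holds]
    have : (fun i => (args i).eval A ν) = fun i => (args i).eval A μ := by
      funext i
      exact (args i).eval_congr fun x hx => h x (by
        simp only [freeVars, Finset.mem_biUnion, Finset.mem_univ, true_and]
        exact ⟨i, hx⟩)
    rw [this]
  | imp φ ψ ihφ ihψ =>
    simp only [freeVars, Finset.mem_union] at h
    simp only [Holds]
    rw [ihφ fun x hx => h x (Or.inl hx), ihψ fun x hx => h x (Or.inr hx)]
  | all x φ ih =>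
    simp only [Holds]
    refine forall_congr' fun a => ih fun y hy => ?_
    by_cases hyx : y = x
    · subst hyx
      simp
    · simp only [ne_eq, hyx, not_false_eq_true, Function.update_of_ne]
      exact h y (by simp [freeVars, hyx, hy])

variable {A : Structure L}

@[simp] theorem holds_neg {φ : Formula L} {ν : Assignment A} :
    φ.neg.Holds A ν ↔ ¬ φ.Holds A ν := Iff.rfl

@[simp] theorem holds_and {φ ψ : Formula L} {ν : Assignment A} :
    (φ.and ψ).Holds A ν ↔ φ.Holds A ν ∧ ψ.Holds A ν := by
  simp only [Formula.and, neg, Holds]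
  tauto

theorem holds_conj {l : List (Formula L)} {ν : Assignment A} :
    (conj l).Holds A ν ↔ ∀ φ ∈ l, φ.Holds A ν := by
  induction l with
  | nil => simp [conj, verum, Holds]
  | cons φ l ih =>
    have : conj (φ :: l) = φ.and (conj l) := rfl
    simp [this, ih]

theorem holds_ex {x : Var L} {φ : Formula L} {ν : Assignment A} :
    (ex x φ).Holds A ν ↔ ∃ a, φ.Holds A (Function.update ν x a) := by
  simp [ex, Holds]

theorem holds_exs {l : List (Var L)} {φ : Formula L} {ν : Assignment A} :
    (exs l φ).Holds A ν ↔ ∃ μ : Assignment A, (∀ x ∉ l, μ x = ν x) ∧ φ.Holds A μ := by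
  induction l generalizing ν with
  | nil =>
    simp only [exs, List.foldr_nil, List.not_mem_nil, not_false_eq_true, forall_const]
    constructor
    · exact fun h => ⟨ν, fun _ => rfl, h⟩
    · rintro ⟨μ, h, hμ⟩
      rwa [← funext h]
  | cons x l ih =>
    have : exs (x :: l) φ = ex x (exs l φ) := rfl
    rw [this, holds_ex]
    simp only [ih]
    constructor
    · rintro ⟨a, μ, h, hμ⟩
      refine ⟨μ, fun y hy => ?_, hμ⟩
      simp only [List.mem_cons, not_or] at hy
      rw [h y hy.2, Function.update_of_ne hy.1]
    · rintro ⟨μ, h, hμ⟩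
      refine ⟨μ x, μ, fun y hy => ?_, hμ⟩
      by_cases hyx : y = x
      · subst hyx
        simp
      · rw [Function.update_of_ne hyx]
        exact h y (by simp [hyx, hy])

theorem IsQF.and {φ ψ : Formula L} (hφ : φ.IsQF) (hψ : ψ.IsQF) : (φ.and ψ).IsQF :=
  ⟨⟨hφ, hψ, trivial⟩, trivial⟩

theorem IsQF.conj {l : List (Formula L)} (h : ∀ φ ∈ l, φ.IsQF) : (Formula.conj l).IsQF := by
  induction l with
  | nil => exact ⟨trivial, trivial⟩
  | cons φ l ih =>
    exact IsQF.and (h φ (by simp)) (ih fun ψ hψ => h ψ (by simp [hψ]))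

theorem freeVars_and (φ ψ : Formula L) : (φ.and ψ).freeVars = φ.freeVars ∪ ψ.freeVars := by
  simp [Formula.and, neg, freeVars]

theorem freeVars_conj_subset {l : List (Formula L)} {V : Finset (Var L)}
    (h : ∀ φ ∈ l, φ.freeVars ⊆ V) : (Formula.conj l).freeVars ⊆ V := by
  induction l with
  | nil => simp [Formula.conj, verum, neg, freeVars]
  | cons φ l ih =>
    have : Formula.conj (φ :: l) = φ.and (Formula.conj l) := rfl
    rw [this, freeVars_and]
    exact Finset.union_subset (h φ (by simp)) (ih fun ψ hψ => h ψ (by simp [hψ]))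

end Formula

theorem isQF_arrangement (V : Finset (Var L)) (E : L.Sorts → Setoid ℕ) :
    (arrangement V E).IsQF := by
  refine Formula.IsQF.conj fun φ hφ => ?_
  obtain ⟨σ, -, rfl⟩ := List.mem_map.1 hφ
  refine Formula.IsQF.conj fun ψ hψ => ?_
  obtain ⟨p, -, rfl⟩ := List.mem_map.1 hψ
  split_ifs
  · trivial
  · exact ⟨trivial, trivial⟩

theorem freeVars_arrangement_subset (V : Finset (Var L)) (E : L.Sorts → Setoid ℕ) :
    (arrangement V E).freeVars ⊆ V := by
  refine Formula.freeVars_conj_subset fun φ hφ => ?_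
  obtain ⟨σ, -, rfl⟩ := List.mem_map.1 hφ
  refine Formula.freeVars_conj_subset fun ψ hψ => ?_
  obtain ⟨p, hp, rfl⟩ := List.mem_map.1 hψ
  have hp : (σ, p.1) ∈ V ∧ (σ, p.2) ∈ V := by simpa using hp
  split_ifs <;>
  simp [Formula.neg, Formula.freeVars, Term.vars, Finset.insert_subset_iff, hp.1, hp.2]

theorem holds_arrangement {A : Structure L} {ν : Assignment A} {V : Finset (Var L)}
    {E : L.Sorts → Setoid ℕ} :
    (arrangement V E).Holds A ν ↔ ∀ σ n m, (σ, n) ∈ V → (σ, m) ∈ V →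
      ((E σ).r n m ↔ ν (σ, n) = ν (σ, m)) := by
  have key : ∀ σ n m, (if (E σ).r n m then Formula.eq (Term.var σ n) (Term.var σ m)
      else (Formula.eq (Term.var σ n) (Term.var σ m)).neg).Holds A ν ↔
      ((E σ).r n m ↔ ν (σ, n) = ν (σ, m)) := by
    intro σ n m
    split_ifs with h <;> simp [h, Formula.Holds, Term.eval]
  simp only [arrangement, Formula.holds_conj, List.forall_mem_map, key]
  constructor
  · intro h σ n m hn hm
    refine h σ ?_ (n, m) ?_
    · simpa using ⟨n, hn⟩
    · simpa using ⟨hn, hm⟩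
  · intro h σ _ p hp
    have hp : (σ, p.1) ∈ V ∧ (σ, p.2) ∈ V := by simpa using hp
    exact h σ p.1 p.2 hp.1 hp.2

/-- Validity of the sentences of a theory does not depend on the assignment. -/
theorem Interpretation.IsModel.congr_val {A : Structure L} {ν : Assignment A} {T : Theory L}
    (h : (⟨A, ν⟩ : Interpretation L).IsModel T) (μ : Assignment A) :
    (⟨A, μ⟩ : Interpretation L).IsModel T := fun ψ hψ =>
  (ψ.1.holds_congr fun x hx => by simp [ψ.2] at hx).1 (h ψ hψ)

end Semantics

/-! ### Reducts, up to isomorphism, and the translation of formulas -/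

section Reduct

variable {K : Signature.{u}} {M M' : Subsignature K}

/-- An isomorphism between the reduct of `C` to a smaller signature and `A`. -/
structure ReductEquiv (h : M ⊆ M') (C : Structure M'.sig) (A : Structure M.sig) where
  equiv : (σ : M.sig.Sorts) → C.carrier ⟨σ.1, h.sorts σ.2⟩ ≃ A.carrier σ
  map_func : ∀ (f : M.sig.Func)
    (args : (i : Fin (M.sig.funcArity f)) → C.carrier ⟨(M.sig.dom f i).1, h.sorts (M.sig.dom f i).2⟩),
    equiv (M.sig.cod f) (C.func ⟨f.1, h.funcs f.2⟩ args) =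
      A.func f fun i => equiv (M.sig.dom f i) (args i)
  map_pred : ∀ (P : M.sig.Pred)
    (args : (i : Fin (M.sig.predArity P)) →
      C.carrier ⟨(M.sig.pdom P i).1, h.sorts (M.sig.pdom P i).2⟩),
    C.pred ⟨P.1, h.preds P.2⟩ args ↔ A.pred P fun i => equiv (M.sig.pdom P i) (args i)

namespace ReductEquiv

variable {h : M ⊆ M'} {C : Structure M'.sig} {A : Structure M.sig}

/-- The assignment on the reduct induced by an assignment. -/
def assignment (e : ReductEquiv h C A) (ν : Assignment C) : Assignment A :=
  fun x => e.equiv x.1 (ν (inclVar h x))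

theorem eval_incl (e : ReductEquiv h C A) (ν : Assignment C) {σ : M.sig.Sorts} (t : Term M.sig σ) :
    e.equiv σ ((t.incl h).eval C ν) = t.eval A (e.assignment ν) := by
  induction t with
  | var σ n => rfl
  | app f args ih =>
    simp only [Term.eval, ← ih]
    exact e.map_func f _

theorem assignment_update {_ : DecidableEq (Var M.sig)} {_ : DecidableEq (Var M'.sig)}
    (e : ReductEquiv h C A) (ν : Assignment C) (x : Var M.sig)
    (a : C.carrier (inclVar h x).1) :
    e.assignment (Function.update ν (inclVar h x) a) =
      Function.update (e.assignment ν) x (e.equiv x.1 a) := by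
  funext y
  by_cases hyx : y = x
  · subst hyx
    simp [assignment]
  · rw [Function.update_of_ne hyx]
    simp only [assignment]
    rw [Function.update_of_ne ((inclVar_injective h).ne hyx)]

theorem holds_incl (e : ReductEquiv h C A) (ν : Assignment C) (φ : Formula M.sig) :
    (φ.incl h).Holds C ν ↔ φ.Holds A (e.assignment ν) := by
  induction φ generalizing ν with
  | falsum => exact Iff.rfl
  | eq s t =>
    simp only [Formula.incl, Formula.Holds, ← e.eval_incl, EmbeddingLike.apply_eq_iff_eq]
  | pred P args =>
    simp only [Formula.incl, Formula.Holds, ← e.eval_incl]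
    exact e.map_pred P _
  | imp φ ψ ihφ ihψ => simp only [Formula.incl, Formula.Holds, ihφ, ihψ]
  | all x φ ih =>
    simp only [Formula.incl, Formula.Holds, ih]
    refine (e.equiv x.1).forall_congr fun a => ?_
    exact iff_of_eq (congrArg _ (e.assignment_update ν x a))

end ReductEquiv

/-- The reduct of a structure to a smaller signature. -/
def Structure.reduct (h : M ⊆ M') (C : Structure M'.sig) : Structure M.sig where
  carrier σ := C.carrier ⟨σ.1, h.sorts σ.2⟩
  nonempty _ := C.nonempty _
  func f args := C.func ⟨f.1, h.funcs f.2⟩ args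
  pred P args := C.pred ⟨P.1, h.preds P.2⟩ args

def Structure.reductEquiv (h : M ⊆ M') (C : Structure M'.sig) :
    ReductEquiv h C (C.reduct h) where
  equiv _ := Equiv.refl _
  map_func _ _ := rfl
  map_pred _ _ := Iff.rfl

theorem holds_arrangement_incl (h : M ⊆ M') {C : Structure M'.sig} {ν : Assignment C}
    {V : Finset (Var M.sig)} {E : M.sig.Sorts → Setoid ℕ} :
    ((arrangement V E).incl h).Holds C ν ↔ ∀ σ n m, (σ, n) ∈ V → (σ, m) ∈ V →
      ((E σ).r n m ↔ ν (inclVar h (σ, n)) = ν (inclVar h (σ, m))) := by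
  rw [(C.reductEquiv h).holds_incl, holds_arrangement]
  rfl

end Reduct

/-! ### Injectivity of Gödel numbers and countability of the language -/

section Countability

variable {L : Signature.{u}}

/-- Variables have even codes and applications odd ones, and pairing and list encoding are
injective. Two sorts are allowed because the sort of the sides of an equation is itself recovered
from their codes. -/
theorem Term.code_injective (N : Numbering L) {σ τ : L.Sorts} (s : Term L σ) (t : Term L τ)
    (h : s.code N = t.code N) : σ = τ ∧ HEq s t := by
  induction s generalizing τ with
  | var σ n =>
    cases t with
    | var τ m =>
      simp only [Term.code, mul_eq_mul_left_iff, Nat.pair_eq_pair, OfNat.ofNat_ne_zero,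
        or_false] at h
      obtain rfl := N.sort_injective h.1
      obtain rfl := h.2
      exact ⟨rfl, HEq.rfl⟩
    | app f args =>
      simp only [Term.code] at h
      omega
  | app f args ih =>
    cases t with
    | var τ m =>
      simp only [Term.code] at h
      omega
    | app g args' =>
      simp only [Term.code, Nat.add_right_cancel_iff, mul_eq_mul_left_iff, Nat.pair_eq_pair,
        OfNat.ofNat_ne_zero, or_false, Encodable.encode_inj] at h
      obtain rfl := N.func_injective h.1
      have h2 := List.ofFn_injective h.2
      have : args = args' := funext fun i => eq_of_heq (ih i _ (congrFun h2 i)).2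
      subst this
      exact ⟨rfl, HEq.rfl⟩

/-- Residues modulo 4 separate the constructors, with 0 itself reserved for `falsum`. This is used
only to see that there are countably many formulas. -/
theorem Formula.code_injective (N : Numbering L) :
    Function.Injective (Formula.code N : Formula L → ℕ) := by
  intro φ
  induction φ with
  | falsum => intro ψ h; cases ψ <;> simp only [Formula.code] at h <;> first | rfl | omega
  | eq s t =>
    intro ψ h
    cases ψ with
    | eq s' t' =>
      simp only [Formula.code, Nat.add_right_cancel_iff, mul_eq_mul_left_iff, Nat.pair_eq_pair,
        OfNat.ofNat_ne_zero, or_false] at h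
      obtain ⟨rfl, hs⟩ := Term.code_injective N s s' h.1
      obtain ⟨-, ht⟩ := Term.code_injective N t t' h.2
      rw [eq_of_heq hs, eq_of_heq ht]
    | _ => simp only [Formula.code] at h; omega
  | pred P args =>
    intro ψ h
    cases ψ with
    | pred Q args' =>
      simp only [Formula.code, Nat.add_right_cancel_iff, mul_eq_mul_left_iff, Nat.pair_eq_pair,
        OfNat.ofNat_ne_zero, or_false, Encodable.encode_inj] at h
      obtain rfl := N.pred_injective h.1
      have h2 := List.ofFn_injective h.2
      have : args = args' :=
        funext fun i => eq_of_heq (Term.code_injective N _ _ (congrFun h2 i)).2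
      rw [this]
    | _ => simp only [Formula.code] at h; omega
  | imp φ ψ ihφ ihψ =>
    intro χ h
    cases χ with
    | imp φ' ψ' =>
      simp only [Formula.code, Nat.add_right_cancel_iff, mul_eq_mul_left_iff, Nat.pair_eq_pair,
        OfNat.ofNat_ne_zero, or_false] at h
      rw [ihφ h.1, ihψ h.2]
    | _ => simp only [Formula.code] at h; omega
  | all x φ ih =>
    intro χ h
    cases χ with
    | all y φ' =>
      simp only [Formula.code, Nat.add_right_cancel_iff, mul_eq_mul_left_iff, Nat.pair_eq_pair,
        OfNat.ofNat_ne_zero, or_false] at h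
      rw [ih h.2, Prod.ext (N.sort_injective h.1.1) h.1.2]
    | _ => simp only [Formula.code] at h; omega

theorem Numbering.countable_sorts (N : Numbering L) : Countable L.Sorts :=
  N.sort_injective.countable

theorem Numbering.countable_formula (N : Numbering L) : Countable (Formula L) :=
  (Formula.code_injective N).countable

theorem Subsignature.IsCountable.nonempty_numbering {K : Signature.{u}} {M : Subsignature K}
    (h : M.IsCountable) : Nonempty (Numbering M.sig) := by
  have := h.sorts.to_subtype
  have := h.funcs.to_subtype
  have := h.preds.to_subtype
  obtain ⟨f, hf⟩ := exists_injective_nat M.sorts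
  obtain ⟨g, hg⟩ := exists_injective_nat M.funcs
  obtain ⟨p, hp⟩ := exists_injective_nat M.preds
  exact ⟨⟨f, g, p, hf, hg, hp⟩⟩

end Countability

/-! ### Downward Löwenheim–Skolem by closing a set of assignments -/

section LowenheimSkolem

variable {L : Signature.{u}}

/-- A value at `x` for which `φ` fails, if there is one. -/
noncomputable def counterexample (A : Structure L) (μ : Assignment A) (x : Var L)
    (φ : Formula L) : A.carrier x.1 :=
  open Classical in
  if h : ∃ a, ¬ φ.Holds A (Function.update μ x a) then h.choose else μ x

theorem holds_all_of_counterexample {A : Structure L} {μ : Assignment A} {x : Var L}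
    {φ : Formula L} (h : φ.Holds A (Function.update μ x (counterexample A μ x φ))) :
    (Formula.all x φ).Holds A μ := by
  intro a
  by_contra ha
  have hex : ∃ a, ¬ φ.Holds A (Function.update μ x a) := ⟨a, ha⟩
  rw [counterexample, dif_pos hex] at h
  exact hex.choose_spec h

/-- The closure of an assignment under updates by counterexamples and by values of other
assignments of the closure. -/
def skolemStage (A : Interpretation L) : ℕ → Set (Assignment A.str)
  | 0 => {A.val}
  | k + 1 => skolemStage A k ∪
      (⋃ p : Var L × Formula L,
        (fun μ => Function.update μ p.1 (counterexample A.str μ p.1 p.2)) '' skolemStage A k) ∪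
      ⋃ p : Var L × ℕ, Set.image2 (fun μ μ' => Function.update μ p.1 (μ' (p.1.1, p.2)))
        (skolemStage A k) (skolemStage A k)

theorem skolemStage_mono (A : Interpretation L) : Monotone (skolemStage A) :=
  monotone_nat_of_le_succ fun _ _ hμ => Or.inl (Or.inl hμ)

theorem countable_skolemStage [Countable L.Sorts] [Countable (Formula L)] (A : Interpretation L)
    (k : ℕ) : (skolemStage A k).Countable := by
  induction k with
  | zero => exact Set.countable_singleton _
  | succ k ih =>
    exact (ih.union (Set.countable_iUnion fun p => ih.image _)).union
      (Set.countable_iUnion fun p => ih.image2 ih _)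

/-- The union of all stages. -/
def skolemClosure (A : Interpretation L) : Set (Assignment A.str) := ⋃ k, skolemStage A k

theorem val_mem_skolemClosure (A : Interpretation L) : A.val ∈ skolemClosure A :=
  Set.mem_iUnion.2 ⟨0, rfl⟩

theorem update_counterexample_mem {A : Interpretation L} {μ : Assignment A.str}
    (hμ : μ ∈ skolemClosure A) (x : Var L) (φ : Formula L) :
    Function.update μ x (counterexample A.str μ x φ) ∈ skolemClosure A := by
  obtain ⟨k, hk⟩ := Set.mem_iUnion.1 hμ
  exact Set.mem_iUnion.2 ⟨k + 1, Or.inl (Or.inr (Set.mem_iUnion.2 ⟨(x, φ), μ, hk, rfl⟩))⟩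

theorem update_value_mem {A : Interpretation L} {μ μ' : Assignment A.str}
    (hμ : μ ∈ skolemClosure A) (hμ' : μ' ∈ skolemClosure A) (x : Var L) (m : ℕ) :
    Function.update μ x (μ' (x.1, m)) ∈ skolemClosure A := by
  obtain ⟨k, hk⟩ := Set.mem_iUnion.1 hμ
  obtain ⟨l, hl⟩ := Set.mem_iUnion.1 hμ'
  exact Set.mem_iUnion.2 ⟨max k l + 1, Or.inr (Set.mem_iUnion.2 ⟨(x, m),
    μ, skolemStage_mono A (le_max_left k l) hk, μ', skolemStage_mono A (le_max_right k l) hl,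
    rfl⟩)⟩

/-- The values of the assignments of the closure. -/
def skolemHull (A : Interpretation L) (σ : L.Sorts) : Set (A.str.carrier σ) :=
  {a | ∃ μ ∈ skolemClosure A, ∃ m, μ (σ, m) = a}

theorem countable_skolemHull [Countable L.Sorts] [Countable (Formula L)] (A : Interpretation L)
    (σ : L.Sorts) : (skolemHull A σ).Countable := by
  have h : (skolemClosure A).Countable := Set.countable_iUnion fun k => countable_skolemStage A k
  refine ((h.prod (Set.countable_univ (α := ℕ))).image fun p => p.1 (σ, p.2)).mono ?_
  rintro a ⟨μ, hμ, m, rfl⟩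
  exact ⟨(μ, m), ⟨hμ, trivial⟩, rfl⟩

theorem apply_mem_skolemHull {A : Interpretation L} {μ : Assignment A.str}
    (hμ : μ ∈ skolemClosure A) (x : Var L) : μ x ∈ skolemHull A x.1 :=
  ⟨μ, hμ, x.2, rfl⟩

theorem update_mem_skolemClosure {A : Interpretation L} {μ : Assignment A.str}
    (hμ : μ ∈ skolemClosure A) (x : Var L) {a : A.str.carrier x.1} (ha : a ∈ skolemHull A x.1) :
    Function.update μ x a ∈ skolemClosure A := by
  obtain ⟨μ', hμ', m, rfl⟩ := ha
  exact update_value_mem hμ hμ' x m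

/-- Overwrite the variables one at a time; their indices are distinct, so later updates do not
disturb earlier ones even when sorts repeat. -/
theorem exists_mem_skolemClosure (A : Interpretation L) {k : ℕ} (s : Fin k → L.Sorts)
    (args : (i : Fin k) → A.str.carrier (s i)) (h : ∀ i, args i ∈ skolemHull A (s i)) :
    ∃ μ ∈ skolemClosure A, ∀ i, μ (s i, i) = args i := by
  suffices H : ∀ l ≤ k, ∃ μ ∈ skolemClosure A, ∀ i : Fin k, i.1 < l → μ (s i, i) = args i by
    obtain ⟨μ, hμ, h⟩ := H k le_rfl
    exact ⟨μ, hμ, fun i => h i i.2⟩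
  intro l
  induction l with
  | zero => exact fun _ => ⟨A.val, val_mem_skolemClosure A, fun i hi => by omega⟩
  | succ l ih =>
    intro hl
    obtain ⟨μ, hμ, hμ'⟩ := ih (by omega)
    refine ⟨_, update_mem_skolemClosure hμ (s ⟨l, hl⟩, l) (h ⟨l, hl⟩), fun i hi => ?_⟩
    by_cases hil : i = ⟨l, hl⟩
    · subst hil
      simp
    · have : i.1 ≠ l := fun e => hil (Fin.ext e)
      rw [Function.update_of_ne fun e => this (congrArg Prod.snd e)]
      exact hμ' i (by omega)

/-- The value of the function is the only counterexample to `x ≠ f(x₀, …)`, so closure under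
counterexamples already yields closure under functions. -/
theorem func_mem_skolemHull (A : Interpretation L) (f : L.Func)
    (args : (i : Fin (L.funcArity f)) → A.str.carrier (L.dom f i))
    (h : ∀ i, args i ∈ skolemHull A (L.dom f i)) :
    A.str.func f args ∈ skolemHull A (L.cod f) := by
  obtain ⟨μ, hμ, hargs⟩ := exists_mem_skolemClosure A _ args h
  -- This index exceeds those of all argument variables, so updating `x` leaves the arguments alone.
  let x : Var L := (L.cod f, L.funcArity f)
  let t : Term L (L.cod f) := .app f fun i => .var (L.dom f i) i
  let φ : Formula L := (Formula.eq (.var (L.cod f) (L.funcArity f)) t).neg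
  have ht : ∀ a : A.str.carrier x.1,
      t.eval A.str (Function.update μ x a) = A.str.func f args := by
    intro a
    simp only [t, Term.eval]
    congr 1
    funext i
    have : ((L.dom f i, i.1) : Var L) ≠ x := fun e => i.2.ne (congrArg Prod.snd e)
    rw [Function.update_of_ne this, hargs]
  have key : ∀ a : A.str.carrier x.1,
      φ.Holds A.str (Function.update μ x a) ↔ a ≠ A.str.func f args := by
    intro a
    simp only [φ, Formula.holds_neg, Formula.Holds, ht, Term.eval]
    rw [show Function.update μ x a (L.cod f, L.funcArity f) = a from Function.update_self x a μ]
  have hmem := apply_mem_skolemHull (update_counterexample_mem hμ x φ) x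
  rw [Function.update_self] at hmem
  by_contra hn
  refine (key _).1 (holds_all_of_counterexample (μ := μ) (x := x) (φ := φ) ((key _).2 ?_) _) rfl
  rintro e
  rw [e] at hmem
  exact hn hmem

/-- The structure induced on the hull. -/
def skolemStructure (A : Interpretation L) : Structure L where
  carrier σ := skolemHull A σ
  nonempty σ := ⟨_, apply_mem_skolemHull (val_mem_skolemClosure A) (σ, 0)⟩
  func f args := ⟨A.str.func f fun i => (args i).1,
    func_mem_skolemHull A f _ fun i => (args i).2⟩
  pred P args := A.str.pred P fun i => (args i).1

theorem eval_skolemStructure (A : Interpretation L) (ν : Assignment (skolemStructure A))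
    {σ : L.Sorts} (t : Term L σ) :
    (t.eval (skolemStructure A) ν).1 = t.eval A.str fun x => (ν x).1 := by
  induction t with
  | var σ n => rfl
  | app f args ih =>
    simp only [Term.eval, ← ih]
    rfl

/-- The Tarski–Vaught argument: a universal formula need only be tested at its chosen
counterexample, which lies in the hull. Counterexamples were added only for assignments in the
closure, hence the restriction; updating by hull elements stays inside it. -/
theorem holds_skolemStructure (A : Interpretation L) (φ : Formula L)
    (ν : Assignment (skolemStructure A)) (hν : (fun x => (ν x).1) ∈ skolemClosure A) :
    φ.Holds (skolemStructure A) ν ↔ φ.Holds A.str fun x => (ν x).1 := by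
  induction φ generalizing ν with
  | falsum => exact Iff.rfl
  | eq s t =>
    simp only [Formula.Holds, ← eval_skolemStructure]
    exact Subtype.ext_iff
  | pred P args =>
    simp only [Formula.Holds, ← eval_skolemStructure]
    rfl
  | imp φ ψ ihφ ihψ => simp only [Formula.Holds, ihφ ν hν, ihψ ν hν]
  | all x φ ih =>
    have hupd : ∀ a : (skolemStructure A).carrier x.1,
        (fun y => (Function.update ν x a y).1) = Function.update (fun y => (ν y).1) x a.1 := by
      intro a
      funext y
      by_cases hyx : y = x
      · subst hyx
        simp
      · simp [hyx]
    have key : ∀ a : (skolemStructure A).carrier x.1,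
        φ.Holds (skolemStructure A) (Function.update ν x a) ↔
          φ.Holds A.str (Function.update (fun y => (ν y).1) x a.1) := by
      intro a
      rw [ih, hupd]
      rw [hupd]
      exact update_mem_skolemClosure hν x a.2
    constructor
    · intro h
      refine holds_all_of_counterexample ?_
      have hm := apply_mem_skolemHull (update_counterexample_mem hν x φ) x
      rw [Function.update_self] at hm
      exact (key ⟨_, hm⟩).1 (h ⟨_, hm⟩)
    · exact fun h a => (key a).2 (h a.1)

/-- The downward Löwenheim–Skolem theorem for countable signatures. -/
theorem exists_countable_elementary [Countable L.Sorts] [Countable (Formula L)]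
    (A : Interpretation L) :
    ∃ B : Interpretation L, (∀ σ, Countable (B.str.carrier σ)) ∧
      (∀ φ, B.Satisfies φ ↔ A.Satisfies φ) ∧
      ∃ ι : (σ : L.Sorts) → B.str.carrier σ → A.str.carrier σ,
        (∀ σ, Function.Injective (ι σ)) ∧ ∀ x, ι x.1 (B.val x) = A.val x :=
  ⟨⟨skolemStructure A, fun x => ⟨A.val x, apply_mem_skolemHull (val_mem_skolemClosure A) x⟩⟩,
    fun σ => (countable_skolemHull A σ).to_subtype,
    fun φ => holds_skolemStructure A φ _ (val_mem_skolemClosure A),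
    fun _ a => a.1, fun _ => Subtype.val_injective, fun _ => rfl⟩

end LowenheimSkolem

/-! ### Ultraproducts and Łoś's theorem -/

section Ultraproduct

open Filter

variable {L : Signature.{u}} {I : Type u}

/-- The ultraproduct of a family of structures. -/
noncomputable def ultraproduct (U : Ultrafilter I) (A : I → Structure L) : Structure L where
  carrier σ := (U : Filter I).Product fun i => (A i).carrier σ
  nonempty σ := ⟨Quotient.mk'' fun i => ((A i).nonempty σ).some⟩
  func f args := Quotient.mk'' fun i => (A i).func f fun j => (args j).out i
  pred P args := ∀ᶠ i in U, (A i).pred P fun j => (args j).out i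

variable {U : Ultrafilter I} {A : I → Structure L}

/-- The element of the ultraproduct represented by a family of elements. -/
def ultraproduct.mk (U : Ultrafilter I) {A : I → Structure L} {σ : L.Sorts}
    (a : (i : I) → (A i).carrier σ) : (ultraproduct U A).carrier σ :=
  Quotient.mk'' a

namespace ultraproduct

theorem mk_eq_mk {σ : L.Sorts} {a b : (i : I) → (A i).carrier σ} :
    mk U a = mk U b ↔ ∀ᶠ i in U, a i = b i :=
  Quotient.eq''

theorem exists_mk {σ : L.Sorts} (x : (ultraproduct U A).carrier σ) :
    ∃ a : (i : I) → (A i).carrier σ, mk U a = x :=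
  ⟨Quotient.out x, Quotient.out_eq' x⟩

/-- Functions and predicates are defined through chosen representatives; this shows that the choice
is immaterial. -/
theorem eventually_out_mk {σ : L.Sorts} (a : (i : I) → (A i).carrier σ) :
    ∀ᶠ i in U, Quotient.out (mk U a) i = a i :=
  mk_eq_mk.1 (Quotient.out_eq' (mk U a))

/-- The assignment represented by a family of assignments. -/
def assignment (U : Ultrafilter I) (ν : (i : I) → Assignment (A i)) :
    Assignment (ultraproduct U A) :=
  fun x => mk U fun i => ν i x

theorem eval_assignment (ν : (i : I) → Assignment (A i)) {σ : L.Sorts} (t : Term L σ) :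
    t.eval (ultraproduct U A) (assignment U ν) = mk U fun i => t.eval (A i) (ν i) := by
  induction t with
  | var σ n => rfl
  | app f args ih =>
    simp only [Term.eval, ih]
    refine mk_eq_mk.2 ?_
    filter_upwards [eventually_all.2 fun j => eventually_out_mk (U := U)
      fun i => (args j).eval (A i) (ν i)] with i hi
    congr 1
    funext j
    exact hi j

theorem update_assignment (ν : (i : I) → Assignment (A i)) (x : Var L)
    (a : (i : I) → (A i).carrier x.1) :
    Function.update (assignment U ν) x (mk U a) =
      assignment U fun i => Function.update (ν i) x (a i) := by
  funext y
  by_cases hyx : y = x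
  · subst hyx
    simp [assignment]
  · simp [assignment, hyx]

/-- Łoś's theorem. -/
theorem holds_iff (ν : (i : I) → Assignment (A i)) (φ : Formula L) :
    φ.Holds (ultraproduct U A) (assignment U ν) ↔ ∀ᶠ i in U, φ.Holds (A i) (ν i) := by
  induction φ generalizing ν with
  | falsum => simp [Formula.Holds, U.neBot.ne]
  | eq s t => simp only [Formula.Holds, eval_assignment, mk_eq_mk]
  | pred P args =>
    simp only [Formula.Holds, eval_assignment]
    refine eventually_congr ?_
    filter_upwards [eventually_all.2 fun j => eventually_out_mk (U := U)
      fun i => (args j).eval (A i) (ν i)] with i hi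
    simp only [hi]
  | imp φ ψ ihφ ihψ => simp only [Formula.Holds, ihφ, ihψ, Ultrafilter.eventually_imp]
  | all x φ ih =>
    simp only [Formula.Holds]
    constructor
    · intro h
      by_contra hn
      rw [← Ultrafilter.eventually_not] at hn
      simp only [not_forall] at hn
      classical
      have := fun i => ((A i).nonempty x.1)
      choose a ha using fun i => (Classical.exists_true_of_nonempty (this i))
      -- A failing element at each index that has one; `a i` is only a default.
      let b : (i : I) → (A i).carrier x.1 := fun i =>
        if hi : ∃ a, ¬ φ.Holds (A i) (Function.update (ν i) x a) then hi.choose else a i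
      have hb := h (mk U b)
      rw [update_assignment, ih] at hb
      obtain ⟨i, hi, hi'⟩ := (hb.and hn).exists
      simp only [b, dif_pos hi'] at hi
      exact hi'.choose_spec hi
    · intro h a
      obtain ⟨b, rfl⟩ := exists_mk a
      rw [update_assignment, ih]
      exact h.mono fun i hi => hi _

end ultraproduct

end Ultraproduct

/-! ### Realising an equivalence relation on all variables -/

section StrongWitness

open Filter

/-- An equivalence relation realised on a finite set by values in an infinite set is realised
everywhere by values that agree with the given ones on that set. -/
theorem exists_realisation_extending {X : Type u} [Infinite X] (W : Finset ℕ) (r : Setoid ℕ)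
    (v : ℕ → X) (h : ∀ n ∈ W, ∀ m ∈ W, (r n m ↔ v n = v m)) :
    ∃ v' : ℕ → X, (∀ n ∈ W, v' n = v n) ∧ ∀ n m, r n m ↔ v' n = v' m := by
  have : Infinite ↥(v '' W)ᶜ := (W.finite_toSet.image v).infinite_compl.to_subtype
  -- Classes that miss `W` take values outside `v '' W`, one for each class through its
  -- representative.
  let g : ℕ ↪ ↥(v '' W)ᶜ := Infinite.natEmbedding _
  let v' : ℕ → X := fun n =>
    if hn : ∃ k ∈ W, r n k then v hn.choose else g (Quotient.mk r n).out
  have h1 : ∀ n k, k ∈ W → r n k → v' n = v k := by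
    intro n k hk hr
    have hn : ∃ k ∈ W, r n k := ⟨k, hk, hr⟩
    simp only [v', dif_pos hn]
    exact (h _ hn.choose_spec.1 _ hk).1 (r.trans (r.symm hn.choose_spec.2) hr)
  have h2 : ∀ n, (¬ ∃ k ∈ W, r n k) → v' n = g (Quotient.mk r n).out := fun n hn => dif_neg hn
  refine ⟨v', fun n hn => h1 n n hn (r.refl n), fun n m => ?_⟩
  by_cases hn : ∃ k ∈ W, r n k <;> by_cases hm : ∃ k ∈ W, r m k
  · obtain ⟨k, hk, hnk⟩ := hn
    obtain ⟨l, hl, hml⟩ := hm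
    rw [h1 n k hk hnk, h1 m l hl hml, ← h k hk l hl]
    exact ⟨fun e => r.trans (r.trans (r.symm hnk) e) hml,
      fun e => r.trans (r.trans hnk e) (r.symm hml)⟩
  · obtain ⟨k, hk, hnk⟩ := hn
    rw [h1 n k hk hnk, h2 m hm]
    refine iff_of_false (fun e => hm ⟨k, hk, r.trans (r.symm e) hnk⟩) fun e => ?_
    exact (g (Quotient.mk r m).out).2 ⟨k, hk, e⟩
  · obtain ⟨k, hk, hmk⟩ := hm
    rw [h1 m k hk hmk, h2 n hn]
    refine iff_of_false (fun e => hn ⟨k, hk, r.trans e hmk⟩) fun e => ?_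
    exact (g (Quotient.mk r n).out).2 ⟨k, hk, e.symm⟩
  · rw [h2 n hn, h2 m hm, Subtype.val_injective.eq_iff, g.injective.eq_iff,
      Quotient.out_inj, Quotient.eq]

variable {L : Signature.{u}}

/-- The free variables of `φ` with sorts in `S`. -/
noncomputable def Formula.freeVarsIn (φ : Formula L) (S : Set L.Sorts) : Finset (Var L) :=
  φ.freeVars.filter fun x => x.1 ∈ S

/-- In a model with infinite sorts in `S` there is room to give new variables values following `E`
without moving the free variables of `φ`. -/
theorem Theory.StablyInfinite.satisfiable_arrangement {T : Theory L} {S : Set L.Sorts}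
    (hinf : T.StablyInfinite S) (φ : QFFormula L) (E : L.Sorts → Setoid ℕ)
    (hsat : T.Satisfiable (φ.1.and (arrangement (φ.1.freeVarsIn S) E)))
    (V : Finset (Var L)) (hV : ∀ x ∈ V, x.1 ∈ S) :
    T.Satisfiable (φ.1.and (arrangement V E)) := by
  -- The arrangement is part of the formula handed to stable infiniteness, so the infinite model
  -- still realises `E` on the variables of `φ`.
  obtain ⟨A, hT, hφ, hA⟩ :=
    hinf ⟨_, φ.2.and (isQF_arrangement (φ.1.freeVarsIn S) E)⟩ hsat
  obtain ⟨hφ, harr⟩ := Formula.holds_and.1 hφ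
  rw [holds_arrangement] at harr
  have key : ∀ σ : L.Sorts, ∃ v : ℕ → A.str.carrier σ,
      (∀ n, (σ, n) ∈ φ.1.freeVars → v n = A.val (σ, n)) ∧
      (σ ∈ S → ∀ n m, E σ n m ↔ v n = v m) := by
    intro σ
    by_cases hσ : σ ∈ S
    · have := hA σ hσ
      let W : Finset ℕ := φ.1.freeVars.preimage (fun n => (σ, n))
        (fun a _ b _ e => congrArg Prod.snd e)
      have hW : ∀ n, n ∈ W ↔ (σ, n) ∈ φ.1.freeVars := fun n => Finset.mem_preimage
      have hWV : ∀ n ∈ W, (σ, n) ∈ φ.1.freeVarsIn S := fun n hn => by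
        simpa [Formula.freeVarsIn, hσ] using (hW n).1 hn
      let v₀ : ℕ → A.str.carrier σ := fun n => A.val (σ, n)
      obtain ⟨v, hv, hv'⟩ := exists_realisation_extending W (E σ) v₀
        fun n hn m hm => harr σ n m (hWV n hn) (hWV m hm)
      exact ⟨v, fun n hn => hv n ((hW n).2 hn), fun _ => hv'⟩
    · exact ⟨fun n => A.val (σ, n), fun _ _ => rfl, fun h => absurd h hσ⟩
  choose v hv hv' using key
  refine ⟨⟨A.str, fun x => v x.1 x.2⟩, hT.congr_val _, Formula.holds_and.2 ⟨?_, ?_⟩⟩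
  · exact (φ.1.holds_congr fun x hx => hv x.1 x.2 hx).2 hφ
  · exact holds_arrangement.2 fun σ n m hn _ => hv' σ (hV _ hn) n m

/-- If the theory is stably infinite and strongly finitely witnessable, a satisfiable arrangement of
the variables of the witness extends to prescribed equivalence relations on all variables of
sorts in `S`, in a countable model in which the sorts with finitely many classes consist of the
values of the variables. -/
theorem Theory.IsStrongWitness.exists_countable_model [Countable L.Sorts] [Countable (Formula L)]
    {T : Theory L} {S : Set L.Sorts} {N : Numbering L} {wit : QFFormula L → QFFormula L}
    (hwit : T.IsStrongWitness S N wit) (hinf : T.StablyInfinite S) (φ : QFFormula L)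
    (E : L.Sorts → Setoid ℕ)
    (hsat : T.Satisfiable ((wit φ).1.and (arrangement ((wit φ).1.freeVarsIn S) E))) :
    ∃ A : Interpretation L, A.IsModel T ∧ A.Satisfies (wit φ).1 ∧
      (∀ σ, Countable (A.str.carrier σ)) ∧
      (∀ σ ∈ S, ∀ n m, E σ n m ↔ A.val (σ, n) = A.val (σ, m)) ∧
      ∀ σ ∈ S, Finite (Quotient (E σ)) → Function.Surjective fun n => A.val (σ, n) := by
  -- Including the variables of the witness ensures that every variable used to name an element is
  -- governed by the arrangement.
  let V : Finset (Var L) → Finset (Var L) := fun F =>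
    (wit φ).1.freeVarsIn S ∪ F.filter fun x => x.1 ∈ S
  have hV : ∀ F, ∀ x ∈ V F, x.1 ∈ S := by
    intro F x hx
    simp only [V, Formula.freeVarsIn, Finset.mem_union, Finset.mem_filter] at hx
    tauto
  choose A hT hA hnamed using fun F => hwit.witness φ (V F) E (hV F)
    (hinf.satisfiable_arrangement (wit φ) E hsat (V F) (hV F))
  have hφ : ∀ F, (A F).Satisfies (wit φ).1 := fun F => (Formula.holds_and.1 (hA F)).1
  have harr := fun F => holds_arrangement.1 (Formula.holds_and.1 (hA F)).2
  replace hnamed : ∀ F, ∀ σ ∈ S, ∀ a, ∃ n, (σ, n) ∈ V F ∧ (A F).val (σ, n) = a := by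
    intro F σ hσ a
    obtain ⟨n, hn, e⟩ := hnamed F σ hσ a
    refine ⟨n, ?_, e⟩
    rw [Formula.freeVars_and, Finset.mem_union] at hn
    rcases hn with hn | hn
    · exact Finset.mem_union_left _ (Finset.mem_filter.2 ⟨hn, hσ⟩)
    · exact freeVars_arrangement_subset _ _ hn
  -- Every cone of finite sets containing a given one belongs to `U`, so each pair of variables is
  -- eventually arranged.
  let U : Ultrafilter (Finset (Var L)) := Ultrafilter.of atTop
  have hU : ∀ F₀ : Finset (Var L), ∀ᶠ F in U, F₀ ⊆ F := fun F₀ =>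
    Ultrafilter.of_le _ (eventually_ge_atTop F₀)
  have hUV : ∀ σ ∈ S, ∀ n, ∀ᶠ F in U, (σ, n) ∈ V F := by
    intro σ hσ n
    filter_upwards [hU {(σ, n)}] with F hF
    exact Finset.mem_union_right _ (Finset.mem_filter.2 ⟨hF (by simp), hσ⟩)
  have hUE : ∀ σ ∈ S, ∀ n m, ∀ᶠ F in U, E σ n m ↔ (A F).val (σ, n) = (A F).val (σ, m) := by
    intro σ hσ n m
    filter_upwards [hUV σ hσ n, hUV σ hσ m] with F h1 h2
    exact harr F σ n m h1 h2
  let ν := ultraproduct.assignment U fun F => (A F).val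
  have hνE : ∀ σ ∈ S, ∀ n m, E σ n m ↔ ν (σ, n) = ν (σ, m) := by
    intro σ hσ n m
    refine Iff.trans ?_ ultraproduct.mk_eq_mk.symm
    constructor
    · intro h
      exact (hUE σ hσ n m).mono fun F hF => hF.1 h
    · intro h
      obtain ⟨F, h1, h2⟩ := (h.and (hUE σ hσ n m)).exists
      exact h2.2 h1
  have hνsurj : ∀ σ ∈ S, Finite (Quotient (E σ)) → ∀ a, ∃ n, ν (σ, n) = a := by
    intro σ hσ hfin a
    obtain ⟨b, rfl⟩ := ultraproduct.exists_mk a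
    by_contra! hne
    -- With finitely many classes, a single index `F` arranges all representatives while `b F`
    -- differs from all their values. But `b F` is the value of some arranged variable, hence of the
    -- representative of its class.
    have h1 : ∀ q : Quotient (E σ), ∀ᶠ F in U, (A F).val (σ, q.out) ≠ b F := fun q =>
      (Ultrafilter.eventually_not).2 fun h => hne q.out (ultraproduct.mk_eq_mk.2 h)
    have h2 : ∀ q : Quotient (E σ), ∀ᶠ F in U, (σ, q.out) ∈ V F := fun q => hUV σ hσ q.out
    obtain ⟨F, h1, h2⟩ := ((eventually_all.2 h1).and (eventually_all.2 h2)).exists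
    obtain ⟨n, hn, e⟩ := hnamed F σ hσ (b F)
    refine h1 (Quotient.mk _ n) ?_
    rw [← e]
    exact (harr F σ _ _ (h2 _) hn).1 (Quotient.mk_out n)
  obtain ⟨B, hB, hBsat, ι, hι, hιval⟩ :=
    exists_countable_elementary ⟨ultraproduct U fun F => (A F).str, ν⟩
  have hval : ∀ σ n m, B.val (σ, n) = B.val (σ, m) ↔ ν (σ, n) = ν (σ, m) := by
    intro σ n m
    have hn : ι σ (B.val (σ, n)) = ν (σ, n) := hιval (σ, n)
    have hm : ι σ (B.val (σ, m)) = ν (σ, m) := hιval (σ, m)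
    rw [← hn, ← hm]
    exact (hι σ).eq_iff.symm
  refine ⟨B, fun ψ hψ => (hBsat _).2 ?_, (hBsat _).2 ?_, hB,
    fun σ hσ n m => (hνE σ hσ n m).trans (hval σ n m).symm, fun σ hσ hfin b => ?_⟩
  · exact (ultraproduct.holds_iff _ _).2 (Eventually.of_forall fun F => hT F ψ hψ)
  · exact (ultraproduct.holds_iff _ _).2 (Eventually.of_forall hφ)
  · obtain ⟨n, hn⟩ := hνsurj σ hσ hfin (ι σ b)
    exact ⟨n, hι σ ((hιval (σ, n)).trans hn)⟩

end StrongWitness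

/-! ### Matching shared sorts and gluing structures -/

section Amalgamation

/-- Equal kernels make `b n ↦ a n` an injection. It is bijective when `Y` is finite; otherwise it
may miss points of `X`, so it is kept only on the finite set `b '' W` and the countably infinite
complements are matched arbitrarily. -/
theorem exists_equiv_of_ker_eq {X Y : Type u} [Countable X] [Countable Y] (a : ℕ → X) (b : ℕ → Y)
    (hab : ∀ n m, b n = b m ↔ a n = a m) (hb : Function.Surjective b)
    (ha : Finite Y → Function.Surjective a) (W : Finset ℕ) :
    ∃ e : Y ≃ X, ∀ n ∈ W, e (b n) = a n := by
  let g : Y → X := fun y => a (Function.surjInv hb y)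
  have hg : ∀ n, g (b n) = a n := fun n => (hab _ _).1 (Function.surjInv_eq hb (b n))
  have hinj : Function.Injective g := by
    intro y z h
    obtain ⟨n, rfl⟩ := hb y
    obtain ⟨m, rfl⟩ := hb z
    rw [hg, hg] at h
    exact (hab n m).2 h
  rcases finite_or_infinite Y with hY | hY
  · refine ⟨Equiv.ofBijective g ⟨hinj, fun x => ?_⟩, fun n _ => hg n⟩
    obtain ⟨n, rfl⟩ := ha hY x
    exact ⟨b n, hg n⟩
  · have hX : Infinite X := Infinite.of_injective g hinj
    let s : Set Y := b '' W
    have hs : s.Finite := W.finite_toSet.image b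
    have : Infinite ↥sᶜ := hs.infinite_compl.to_subtype
    have : Infinite ↥(g '' s)ᶜ := (hs.image g).infinite_compl.to_subtype
    obtain ⟨e⟩ := nonempty_equiv_of_countable (α := ↥sᶜ) (β := ↥(g '' s)ᶜ)
    refine ⟨(Equiv.Set.sumCompl s).symm.trans
      (((Equiv.Set.image g s hinj).sumCongr e).trans (Equiv.Set.sumCompl (g '' s))),
      fun n hn => ?_⟩
    have hbn : b n ∈ s := ⟨n, hn, rfl⟩
    simp [Equiv.Set.sumCompl_symm_apply_of_mem hbn, hg]

theorem exists_surjective_eqOn {X : Type u} [Countable X] [Nonempty X] (v : ℕ → X)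
    (W : Finset ℕ) : ∃ v' : ℕ → X, Function.Surjective v' ∧ ∀ n ∈ W, v' n = v n := by
  obtain ⟨s, hs⟩ := exists_surjective_nat X
  obtain ⟨M, hM⟩ := W.exists_nat_subset_range
  -- The enumeration `s` is shifted past a bound `M` for `W`, so nothing on `W` is overwritten.
  refine ⟨fun n => if n < M then v n else s (n - M), fun x => ?_, fun n hn => ?_⟩
  · obtain ⟨n, rfl⟩ := hs x
    exact ⟨n + M, by simp⟩
  · exact if_pos (Finset.mem_range.1 (hM hn))

variable {K : Signature.{u}} {L₁ L₂ : Subsignature K}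

/-- Structures over signatures that share only sorts, with bijections between the interpretations of
the shared sorts, have a common expansion. -/
theorem exists_amalgam (hdisj : L₁.SharesOnlySorts L₂) (A₁ : Structure L₁.sig)
    (A₂ : Structure L₂.sig)
    (f : ∀ σ (h₁ : σ ∈ L₁.sorts) (h₂ : σ ∈ L₂.sorts),
      A₂.carrier ⟨σ, h₂⟩ ≃ A₁.carrier ⟨σ, h₁⟩) :
    ∃ (C : Structure (L₁ ∪ L₂).sig) (e₁ : ReductEquiv (L₁.subset_union_left L₂) C A₁)
      (e₂ : ReductEquiv (L₁.subset_union_right L₂) C A₂),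
      ∀ σ (h₁ : σ ∈ L₁.sorts) (h₂ : σ ∈ L₂.sorts) (x : C.carrier ⟨σ, Or.inl h₁⟩),
        e₁.equiv ⟨σ, h₁⟩ x = f σ h₁ h₂ (e₂.equiv ⟨σ, h₂⟩ x) := by
  -- Shared sorts take their carrier from `A₂`; the symbols of `L₁` are transported to it along `f`.
  let X : (L₁ ∪ L₂).sig.Sorts → Type u := fun σ =>
    if h : σ.1 ∈ L₂.sorts then A₂.carrier ⟨σ.1, h⟩ else A₁.carrier ⟨σ.1, σ.2.resolve_right h⟩
  let e₂ : ∀ σ (h₂ : σ ∈ L₂.sorts), X ⟨σ, Or.inr h₂⟩ ≃ A₂.carrier ⟨σ, h₂⟩ :=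
    fun σ h₂ => Equiv.cast (dif_pos h₂)
  let e₁ : ∀ σ (h₁ : σ ∈ L₁.sorts), X ⟨σ, Or.inl h₁⟩ ≃ A₁.carrier ⟨σ, h₁⟩ := fun σ h₁ =>
    if h₂ : σ ∈ L₂.sorts then (e₂ σ h₂).trans (f σ h₁ h₂) else Equiv.cast (dif_neg h₂)
  have he : ∀ σ h₁ h₂ x, e₁ σ h₁ x = f σ h₁ h₂ (e₂ σ h₂ x) := by
    intro σ h₁ h₂ x
    simp only [e₁, dif_pos h₂]
    rfl
  let C : Structure (L₁ ∪ L₂).sig :=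
    { carrier := X
      nonempty := fun σ => by
        rcases σ.2 with h | h
        · exact (e₁ σ.1 h).nonempty_congr.2 (A₁.nonempty _)
        · exact (e₂ σ.1 h).nonempty_congr.2 (A₂.nonempty _)
      func := fun F args =>
        if hF : F.1 ∈ L₁.funcs then
          (e₁ (K.cod F.1) (L₁.cod_mem _ hF)).symm
            (A₁.func ⟨F.1, hF⟩ fun i => e₁ (K.dom F.1 i) (L₁.dom_mem _ hF i) (args i))
        else
          (e₂ (K.cod F.1) (L₂.cod_mem _ (F.2.resolve_left hF))).symm
            (A₂.func ⟨F.1, F.2.resolve_left hF⟩ fun i =>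
              e₂ (K.dom F.1 i) (L₂.dom_mem _ (F.2.resolve_left hF) i) (args i))
      pred := fun P args =>
        if hP : P.1 ∈ L₁.preds then
          A₁.pred ⟨P.1, hP⟩ fun i => e₁ (K.pdom P.1 i) (L₁.pdom_mem _ hP i) (args i)
        else
          A₂.pred ⟨P.1, P.2.resolve_left hP⟩ fun i =>
            e₂ (K.pdom P.1 i) (L₂.pdom_mem _ (P.2.resolve_left hP) i) (args i) }
  refine ⟨C, ⟨fun σ => e₁ σ.1 σ.2, fun F args => ?_, fun P args => ?_⟩,
    ⟨fun σ => e₂ σ.1 σ.2, fun F args => ?_, fun P args => ?_⟩, he⟩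
  · simp only [C, dif_pos F.2]
    exact Equiv.apply_symm_apply _ _
  · simp only [C, dif_pos P.2]
  -- Disjointness excludes a conflicting interpretation of the symbol coming from `A₁`.
  · have hF : F.1 ∉ L₁.funcs := fun h => Set.disjoint_left.1 hdisj.funcs h F.2
    simp only [C, dif_neg hF]
    exact Equiv.apply_symm_apply _ _
  · have hP : P.1 ∉ L₁.preds := fun h => Set.disjoint_left.1 hdisj.preds h P.2
    simp only [C, dif_neg hP]

theorem isModel_union_iff {T₁ : Theory L₁.sig} {T₂ : Theory L₂.sig}
    {A₁ : Structure L₁.sig} {A₂ : Structure L₂.sig} {C : Structure (L₁ ∪ L₂).sig}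
    (e₁ : ReductEquiv (L₁.subset_union_left L₂) C A₁)
    (e₂ : ReductEquiv (L₁.subset_union_right L₂) C A₂) (ν : Assignment C) :
    (⟨C, ν⟩ : Interpretation _).IsModel (T₁.union T₂) ↔
      (⟨A₁, e₁.assignment ν⟩ : Interpretation _).IsModel T₁ ∧
        (⟨A₂, e₂.assignment ν⟩ : Interpretation _).IsModel T₂ := by
  constructor
  · intro h
    exact ⟨fun ψ hψ => (e₁.holds_incl ν ψ.1).1 (h _ (Or.inl ⟨ψ, hψ, rfl⟩)),
      fun ψ hψ => (e₂.holds_incl ν ψ.1).1 (h _ (Or.inr ⟨ψ, hψ, rfl⟩))⟩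
  · rintro ⟨h₁, h₂⟩ ψ (⟨χ, hχ, rfl⟩ | ⟨χ, hχ, rfl⟩)
    · exact (e₁.holds_incl ν χ.1).2 (h₁ χ hχ)
    · exact (e₂.holds_incl ν χ.1).2 (h₂ χ hχ)

theorem mem_sharedVars {φ : Formula L₁.sig} {x : Var (L₁ ∩ L₂).sig} :
    x ∈ sharedVars L₁ L₂ φ ↔ inclVar (L₁.inter_subset_left L₂) x ∈ φ.freeVars :=
  Finset.mem_preimage

end Amalgamation

/-! ### The two directions of the combination theorem -/

section Combination

variable {K : Signature.{u}} {L₁ L₂ : Subsignature K} {T₁ : Theory L₁.sig} {T₂ : Theory L₂.sig}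
  {N : Numbering L₁.sig} {wit : QFFormula L₁.sig → QFFormula L₁.sig}

theorem exists_arrangement_of_satisfiable_union (φ₁ : QFFormula L₁.sig) (φ₂ : QFFormula L₂.sig)
    (hwit : T₁.IsStrongWitness (sharedSorts L₁ L₂) N wit)
    (hfresh : ∀ x : Var (L₁ ∩ L₂).sig,
        inclVar (L₁.inter_subset_left L₂) x ∈ (wit φ₁).1.freeVars →
        inclVar (L₁.inter_subset_right L₂) x ∈ φ₂.1.freeVars →
        inclVar (L₁.inter_subset_left L₂) x ∈ φ₁.1.freeVars)
    (hsat : (T₁.union T₂).Satisfiable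
        ((φ₁.1.incl (L₁.subset_union_left L₂)).and (φ₂.1.incl (L₁.subset_union_right L₂)))) :
    ∃ E : (L₁ ∩ L₂).sig.Sorts → Setoid ℕ,
        T₁.Satisfiable ((wit φ₁).1.and
          ((arrangement (sharedVars L₁ L₂ (wit φ₁).1) E).incl (L₁.inter_subset_left L₂))) ∧
        T₂.Satisfiable (φ₂.1.and
          ((arrangement (sharedVars L₁ L₂ (wit φ₁).1) E).incl (L₁.inter_subset_right L₂))) := by
  obtain ⟨⟨C, ν⟩, hT, hφ⟩ := hsat
  let e₁ := C.reductEquiv (L₁.subset_union_left L₂)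
  let e₂ := C.reductEquiv (L₁.subset_union_right L₂)
  obtain ⟨hT₁, hT₂⟩ := (isModel_union_iff e₁ e₂ ν).1 hT
  obtain ⟨hφ₁, hφ₂⟩ := Formula.holds_and.1 hφ
  replace hφ₁ := (e₁.holds_incl ν _).1 hφ₁
  replace hφ₂ := (e₂.holds_incl ν _).1 hφ₂
  obtain ⟨μ, hμν, hμ⟩ := Formula.holds_exs.1 ((hwit.equivalent φ₁ ⟨_, _⟩ hT₁).1 hφ₁)
  -- On shared sorts both sides must use the witness values, so that one arrangement fits both.
  let μ₂ : Assignment (C.reduct (L₁.subset_union_right L₂)) := fun x =>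
    if h : x.1.1 ∈ L₁.sorts then μ (⟨x.1.1, h⟩, x.2) else e₂.assignment ν x
  have hμ₂ : ∀ x : Var (L₁ ∩ L₂).sig, μ₂ (inclVar (L₁.inter_subset_right L₂) x) =
      μ (inclVar (L₁.inter_subset_left L₂) x) := fun x => dif_pos x.1.2.1
  have hμ₂' : ∀ x : Var L₂.sig, x.1.1 ∉ L₁.sorts → μ₂ x = e₂.assignment ν x :=
    fun x h => dif_neg h
  let v : ∀ σ : (L₁ ∩ L₂).sig.Sorts, ℕ → C.carrier ⟨σ.1, Or.inl σ.2.1⟩ :=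
    fun σ n => μ (inclVar (L₁.inter_subset_left L₂) (σ, n))
  refine ⟨fun σ => Setoid.ker (v σ),
    ⟨⟨_, μ⟩, hT₁.congr_val μ, Formula.holds_and.2 ⟨hμ, ?_⟩⟩,
    ⟨⟨_, μ₂⟩, hT₂.congr_val μ₂, Formula.holds_and.2 ⟨?_, ?_⟩⟩⟩
  · exact (holds_arrangement_incl _).2 fun σ n m _ _ => Iff.rfl
  · refine (φ₂.1.holds_congr fun x hx => ?_).1 hφ₂
    by_cases h : x.1.1 ∈ L₁.sorts
    · let y : Var (L₁ ∩ L₂).sig := (⟨x.1.1, h, x.1.2⟩, x.2)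
      refine Eq.trans ?_ (hμ₂ y).symm
      -- Only variables introduced by `wit` may have changed value, and freshness keeps these out of
      -- `φ₂`.
      refine (hμν (inclVar (L₁.inter_subset_left L₂) y) fun hy => ?_).symm
      simp only [Finset.mem_toList, Finset.mem_sdiff] at hy
      exact hy.2 (hfresh y hy.1 hx)
    · exact (hμ₂' x h).symm
  · refine (holds_arrangement_incl _).2 fun σ n m _ _ => ?_
    exact iff_of_eq (congrArg₂ Eq (hμ₂ (σ, n)) (hμ₂ (σ, m))).symm

theorem satisfiable_union_of_arrangement (hcount₂ : L₂.IsCountable)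
    (hdisj : L₁.SharesOnlySorts L₂) (φ₁ : QFFormula L₁.sig) (φ₂ : QFFormula L₂.sig)
    (hinf : T₁.StablyInfinite (sharedSorts L₁ L₂))
    (hwit : T₁.IsStrongWitness (sharedSorts L₁ L₂) N wit)
    (E : (L₁ ∩ L₂).sig.Sorts → Setoid ℕ)
    (hsat₁ : T₁.Satisfiable ((wit φ₁).1.and
      ((arrangement (sharedVars L₁ L₂ (wit φ₁).1) E).incl (L₁.inter_subset_left L₂))))
    (hsat₂ : T₂.Satisfiable (φ₂.1.and
      ((arrangement (sharedVars L₁ L₂ (wit φ₁).1) E).incl (L₁.inter_subset_right L₂)))) :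
    (T₁.union T₂).Satisfiable
      ((φ₁.1.incl (L₁.subset_union_left L₂)).and (φ₂.1.incl (L₁.subset_union_right L₂))) := by
  obtain ⟨N₂⟩ := hcount₂.nonempty_numbering
  have := N.countable_sorts
  have := N₂.countable_sorts
  have := N.countable_formula
  have := N₂.countable_formula
  obtain ⟨A₀, hA₀, hwA₀⟩ := hsat₁
  obtain ⟨hwA₀, harrA₀⟩ := Formula.holds_and.1 hwA₀
  obtain ⟨B₀, hB₀, hφB₀⟩ := hsat₂
  obtain ⟨B, hBc, hBB₀, -⟩ := exists_countable_elementary B₀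
  have hB : B.IsModel T₂ := fun ψ hψ => (hBB₀ _).2 (hB₀ ψ hψ)
  obtain ⟨hφB, harrB⟩ := Formula.holds_and.1 ((hBB₀ _).2 hφB₀)
  -- Only these finitely many values of `B` matter; all other variables are free to enumerate its
  -- elements.
  let V₂ : Finset (Var L₂.sig) := φ₂.1.freeVars ∪
    (sharedVars L₁ L₂ (wit φ₁).1).image (inclVar (L₁.inter_subset_right L₂))
  have hb : ∀ σ : L₂.sig.Sorts, ∃ v : ℕ → B.str.carrier σ, Function.Surjective v ∧
      ∀ n, (σ, n) ∈ V₂ → v n = B.val (σ, n) := by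
    intro σ
    have := hBc σ
    have := B.str.nonempty σ
    let v₀ : ℕ → B.str.carrier σ := fun n => B.val (σ, n)
    obtain ⟨v, hv, hv'⟩ := exists_surjective_eqOn v₀ (V₂.image Prod.snd)
    exact ⟨v, hv, fun n hn => hv' n (Finset.mem_image_of_mem Prod.snd hn)⟩
  choose b hbsurj hbval using hb
  -- The relation to be imitated; `⊤` on unshared sorts is an arbitrary default.
  let E₁ : L₁.sig.Sorts → Setoid ℕ := fun σ =>
    if h : σ.1 ∈ L₂.sorts then Setoid.ker (b ⟨σ.1, h⟩) else ⊤
  have hE₁ : ∀ (σ : L₁.sig.Sorts) (h : σ.1 ∈ L₂.sorts), E₁ σ = Setoid.ker (b ⟨σ.1, h⟩) :=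
    fun σ h => dif_pos h
  have hsat : T₁.Satisfiable ((wit φ₁).1.and
      (arrangement ((wit φ₁).1.freeVarsIn (sharedSorts L₁ L₂)) E₁)) := by
    -- On the shared variables of the witness, `E₁` coincides with `E`: there `b` agrees with `B`,
    -- which realises the same arrangement as `A₀`.
    refine ⟨A₀, hA₀, Formula.holds_and.2 ⟨hwA₀, holds_arrangement.2 fun σ n m hn hm => ?_⟩⟩
    obtain ⟨hn, hσ⟩ := Finset.mem_filter.1 hn
    obtain ⟨hm, -⟩ := Finset.mem_filter.1 hm
    let τ : (L₁ ∩ L₂).sig.Sorts := ⟨σ.1, σ.2, hσ⟩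
    have hn' : (τ, n) ∈ sharedVars L₁ L₂ (wit φ₁).1 := mem_sharedVars.2 hn
    have hm' : (τ, m) ∈ sharedVars L₁ L₂ (wit φ₁).1 := mem_sharedVars.2 hm
    have hbn := hbval ⟨σ.1, hσ⟩ n (Finset.mem_union_right _ (Finset.mem_image_of_mem _ hn'))
    have hbm := hbval ⟨σ.1, hσ⟩ m (Finset.mem_union_right _ (Finset.mem_image_of_mem _ hm'))
    have h1 := (holds_arrangement_incl _).1 harrA₀ τ n m hn' hm'
    have h2 := (holds_arrangement_incl _).1 harrB τ n m hn' hm'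
    rw [hE₁ σ hσ]
    change b ⟨σ.1, hσ⟩ n = b ⟨σ.1, hσ⟩ m ↔ _
    rw [hbn, hbm]
    exact h2.symm.trans h1
  obtain ⟨A, hA, hwA, hAc, hAE, hAsurj⟩ := hwit.exists_countable_model hinf φ₁ E₁ hsat
  have hf : ∀ σ (h₁ : σ ∈ L₁.sorts) (h₂ : σ ∈ L₂.sorts),
      ∃ e : B.str.carrier ⟨σ, h₂⟩ ≃ A.str.carrier ⟨σ, h₁⟩,
        ∀ n, ((⟨σ, h₁⟩, n) : Var L₁.sig) ∈ (wit φ₁).1.freeVars →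
          e (b ⟨σ, h₂⟩ n) = A.val (⟨σ, h₁⟩, n) := by
    intro σ h₁ h₂
    have := hAc ⟨σ, h₁⟩
    have := hBc ⟨σ, h₂⟩
    have hE := hE₁ ⟨σ, h₁⟩ h₂
    let a : ℕ → A.str.carrier ⟨σ, h₁⟩ := fun n => A.val (⟨σ, h₁⟩, n)
    obtain ⟨e, he⟩ := exists_equiv_of_ker_eq a (b ⟨σ, h₂⟩)
      (fun n m => by
        rw [← hAE ⟨σ, h₁⟩ h₂ n m, hE]
        exact Iff.rfl)
      (hbsurj ⟨σ, h₂⟩)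
      (fun hfin => hAsurj ⟨σ, h₁⟩ h₂ (by
        rw [hE]
        exact Finite.of_injective _ (Setoid.kerLift_injective (b ⟨σ, h₂⟩))))
      ((wit φ₁).1.freeVars.image Prod.snd)
    exact ⟨e, fun n hn => he n (Finset.mem_image_of_mem Prod.snd hn)⟩
  choose f hf using hf
  obtain ⟨C, e₁, e₂, he⟩ := exists_amalgam hdisj A.str B.str f
  -- Values come from `b` on sorts of `L₂` and from `A` elsewhere. Since `f` carries `b` to `A` on
  -- the shared variables of the witness, and `b` agrees with `B` on those of `φ₂`, both formulas
  -- stay true.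
  let ν : Assignment C := fun x =>
    if h : x.1.1 ∈ L₂.sorts then (e₂.equiv ⟨x.1.1, h⟩).symm (b ⟨x.1.1, h⟩ x.2)
    else (e₁.equiv ⟨x.1.1, x.1.2.resolve_right h⟩).symm
      (A.val (⟨x.1.1, x.1.2.resolve_right h⟩, x.2))
  have hν₂ : ∀ x, e₂.assignment ν x = b x.1 x.2 := by
    intro x
    have hx : (inclVar (L₁.subset_union_right L₂) x).1.1 ∈ L₂.sorts := x.1.2
    simp only [ReductEquiv.assignment, ν, dif_pos hx]
    exact Equiv.apply_symm_apply _ _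
  have hν₁ : ∀ x ∈ (wit φ₁).1.freeVars, A.val x = e₁.assignment ν x := by
    intro x hx
    by_cases h : x.1.1 ∈ L₂.sorts
    · have h1 := he x.1.1 x.1.2 h (ν (inclVar (L₁.subset_union_left L₂) x))
      refine Eq.trans ?_ h1.symm
      rw [← hf x.1.1 x.1.2 h x.2 hx]
      exact congrArg _ (hν₂ (⟨x.1.1, h⟩, x.2)).symm
    · have hx : (inclVar (L₁.subset_union_left L₂) x).1.1 ∉ L₂.sorts := h
      simp only [ReductEquiv.assignment, ν, dif_neg hx]
      exact (Equiv.apply_symm_apply _ _).symm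
  have hT₁ := hA.congr_val (e₁.assignment ν)
  refine ⟨⟨C, ν⟩, (isModel_union_iff e₁ e₂ ν).2 ⟨hT₁, hB.congr_val _⟩,
    Formula.holds_and.2 ⟨(e₁.holds_incl ν _).2 ?_, (e₂.holds_incl ν _).2 ?_⟩⟩
  · exact (hwit.equivalent φ₁ ⟨_, _⟩ hT₁).2 (Formula.holds_exs.2
      ⟨_, fun _ _ => rfl, ((wit φ₁).1.holds_congr hν₁).1 hwA⟩)
  · refine (φ₂.1.holds_congr fun x hx => ?_).1 hφB
    rw [hν₂]
    exact (hbval x.1 x.2 (Finset.mem_union_left _ hx)).symm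

end Combination

end ManySorted

theorem mainTheorem3 {K : Signature.{u}} (L₁ L₂ : Subsignature K)
    (hne₁ : L₁.sorts.Nonempty) (hne₂ : L₂.sorts.Nonempty)
    (hcount₁ : L₁.IsCountable) (hcount₂ : L₂.IsCountable)
    (hdisj : L₁.SharesOnlySorts L₂)
    (T₁ : Theory L₁.sig) (T₂ : Theory L₂.sig)
    (φ₁ : QFFormula L₁.sig) (φ₂ : QFFormula L₂.sig)
    (hinf : T₁.StablyInfinite (sharedSorts L₁ L₂))
    (N : Numbering L₁.sig) (wit : QFFormula L₁.sig → QFFormula L₁.sig)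
    (hwit : T₁.IsStrongWitness (sharedSorts L₁ L₂) N wit) :
    -- if the variables introduced by `wit` are fresh for `φ₂`, then "only if" holds
    ((∀ x : Var (L₁ ∩ L₂).sig,
        inclVar (L₁.inter_subset_left L₂) x ∈ (wit φ₁).1.freeVars →
        inclVar (L₁.inter_subset_right L₂) x ∈ φ₂.1.freeVars →
        inclVar (L₁.inter_subset_left L₂) x ∈ φ₁.1.freeVars) →
      (T₁.union T₂).Satisfiable
        ((φ₁.1.incl (L₁.subset_union_left L₂)).and (φ₂.1.incl (L₁.subset_union_right L₂))) →
      ∃ E : (L₁ ∩ L₂).sig.Sorts → Setoid ℕ,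
        T₁.Satisfiable ((wit φ₁).1.and
          ((arrangement (sharedVars L₁ L₂ (wit φ₁).1) E).incl (L₁.inter_subset_left L₂))) ∧
        T₂.Satisfiable (φ₂.1.and
          ((arrangement (sharedVars L₁ L₂ (wit φ₁).1) E).incl (L₁.inter_subset_right L₂)))) ∧
    -- "if" holds without any such assumption
    ((∃ E : (L₁ ∩ L₂).sig.Sorts → Setoid ℕ,
        T₁.Satisfiable ((wit φ₁).1.and
          ((arrangement (sharedVars L₁ L₂ (wit φ₁).1) E).incl (L₁.inter_subset_left L₂))) ∧
        T₂.Satisfiable (φ₂.1.and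
          ((arrangement (sharedVars L₁ L₂ (wit φ₁).1) E).incl (L₁.inter_subset_right L₂)))) →
      (T₁.union T₂).Satisfiable
        ((φ₁.1.incl (L₁.subset_union_left L₂)).and (φ₂.1.incl (L₁.subset_union_right L₂)))) := by
  exact ⟨exists_arrangement_of_satisfiable_union φ₁ φ₂ hwit, fun ⟨E, hsat₁, hsat₂⟩ =>
    satisfiable_union_of_arrangement hcount₂ hdisj φ₁ φ₂ hinf hwit E hsat₁ hsat₂⟩
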